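/- Setting. Let $d,\alpha\ge 1$ be integers, $\gamma>0$, and let $(\mathbb A,\Theta)$ be a Borel space (i.e. a standard Borel space) with a probability measure $\Theta$. For $j=1,\dots,\alpha$ let $\varphi_j:(\mathbb R^d\times\mathbb A)^{j+1}\to[0,1]$ be measurable, symmetric, and translation-invariant: $\varphi_j((x_0+t,a_0),\dots,(x_j+t,a_j))=\varphi_j((x_0,a_0),\dots,(x_j,a_j))$ for all $t\in\mathbb R^d$. Put $\mathbb M:=\prod_{j=1}^{\alpha}[0,1]^{\mathbb N^{2j}}$, let $\mathbb Q$ be the product of uniform distributions on $\mathbb M$, and, on a probability space $(\Omega,\mathcal A,\mathbb P)$, let $\Psi$ be a Poisson process on $\mathbb R^d\times\mathbb A\times[0,1]\times\mathbb M$ with intensity measure $\gamma\lambda_d\otimes\Theta\otimes\mathcal U([0,1])\otimes\mathbb Q$, regarded as a random element of the space of counting measures that are finite on $B\times\mathbb A\times[0,1]\times\mathbb M$ for every bounded Borel set $B\subseteq\mathbb R^d$. Let $V\sim\Theta$ and $U\sim\mathbb Q$ be random elements on the same space such that $V,U,\Psi$ are independent. The complex. Fix an enumeration $z_0=\mathbf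 0,z_1,z_2,\dots$ of $\mathbb Z^d$ and put $Q_k:=[0,1)^d+z_k$. For a counting measure $\psi$ as above, a point $(x,a,t,u)$ of $\psi$ with $x\in Q_k$ has coordinates $(k,i)$ in $\psi$ if it has the $i$-th smallest $t$-component among the points of $\psi$ in $Q_k\times\mathbb A\times[0,1]\times\mathbb M$. Let $T(\psi)$ be the simplicial complex whose vertices are the pairs $(x,a)$ for the points $(x,a,t,u)$ of $\psi$ and in which a nonempty set $\sigma$ of at most $\alpha+1$ vertices is a simplex if and only if, for every $\rho\subseteq\sigma$ with $|\rho|=j+1\ge 2$, coming from points $(x_0,a_0,t_0,u^{(0)}),\dots,(x_j,a_j,t_j,u^{(j)})$ of $\psi$ with $t_0<\dots<t_j$ and coordinates $(m_0,l_0),\dots,(m_j,l_j)$, $$u^{(j)}_{m_0,l_0,\dots,m_{j-1},l_{j-1}}\le\varphi_j\big((x_0,a_0),\dots,(x_j,a_j)\big).$$ (Configurations with ties between the $t$-components or with coinciding vertices occur with probability $0$.) For $W\subseteq\mathbb R^d$, a subscript $W$ denotes restriction to the simplices with all vertices in $W\times\mathbb A$. Let $\Delta:=T(\Psi)$, $\Delta^{(x,a,t,u)}:=T(\Psi+\delta_{(x,a,t,u)})$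 and, for a real-valued function $f$ on finite simplicial complexes with vertices in $\mathbb R^d\times\mathbb A$ and bounded $W$, $$\Lambda_{(x,a,t,u)}f(\Delta_W):=f\big(\Delta_W^{(x,a,t,u)}\big)-f\big(\Delta_{W\setminus\{x\}}^{(x,a,t,u)}\big).$$ Definitions. A cube is a set $\prod_{i=1}^d[c_i,c_i+s)$ with $c\in\mathbb R^d$ and $s>0$. For a sequence of cubes, $W_n\to\mathbb R^d$ means that every bounded set $B\subset\mathbb R^d$ satisfies $B\subseteq W_n$ for all sufficiently large $n$; the sequence is increasing if $W_n\subseteq W_{n+1}$ for all $n$. The function $f$ is translation-invariant if $f(K)=f(K+t)$ for all finite complexes $K$ with vertices in $\mathbb R^d\times\mathbb A$ and all $t\in\mathbb R^d$, where $K+t$ is obtained by translating the $\mathbb R^d$-components of the vertices. It is weakly stabilizing if it is translation-invariant and there is a real-valued random variable $Z$ such that $\Lambda_{(\mathbf 0,V,1,U)}f(\Delta_{W_n})\to Z$ in probability for every sequence of cubes with $W_n\to\mathbb R^d$. Proposition. For a translation-invariant functional $f$ on finite simplicial complexes with vertices in $\mathbb R^d\times\mathbb A$, the following are equivalent: (i)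 $f$ is weakly stabilizing. (ii) For every increasing sequence of cubes $(W_n)_{n\in\mathbb N}$ with $W_n\to\mathbb R^d$, the sequence $\Lambda_{(\mathbf 0,V,1,U)}f(\Delta_{W_n})$ converges in probability as $n\to\infty$ to some real-valued random variable, which may depend on the sequence $(W_n)$. -/

import Mathlib

open MeasureTheory ProbabilityTheory Filter Topology
open scoped ENNReal

namespace RCM

/-! ### Locally finite counting measures and Poisson processes -/

/-- The Euclidean space `ℝ^d`. -/
abbrev Space (d : ℕ) : Type := EuclideanSpace ℝ (Fin d)

/-- `η` is a locally finite counting measure on `ℝ^d × Y`: it takes values in `ℕ ∪ {∞}`, and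
`η (B × Y) < ∞` for all bounded Borel sets `B ⊆ ℝ^d`. -/
structure IsLocallyFiniteCounting {d : ℕ} {Y : Type*} [MeasurableSpace Y]
    (η : Measure (Space d × Y)) : Prop where
  counting : ∀ B : Set (Space d × Y), MeasurableSet B → η B = ∞ ∨ ∃ n : ℕ, η B = n
  locallyFinite : ∀ B : Set (Space d), MeasurableSet B → Bornology.IsBounded B →
    η (B ×ˢ (Set.univ : Set Y)) < ∞

/-- The space of locally finite counting measures on `ℝ^d × Y`. As a subtype of `Measure` it carries
the smallest `σ`-field for which all evaluations `η ↦ η B`, `B` measurable, are measurable. -/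
abbrev CountingMeasure (d : ℕ) (Y : Type*) [MeasurableSpace Y] : Type _ :=
  {η : Measure (Space d × Y) // IsLocallyFiniteCounting η}

/-- The points (atoms) of a counting measure. -/
def points {d : ℕ} {Y : Type*} [MeasurableSpace Y] (η : CountingMeasure d Y) :
    Set (Space d × Y) :=
  {p | η.1 {p} ≠ 0}

/-- The counting measure `η + δ_p`. -/
noncomputable def addPoint {d : ℕ} {Y : Type*} [MeasurableSpace Y] (η : CountingMeasure d Y)
    (p : Space d × Y) : CountingMeasure d Y :=
  ⟨η.1 + Measure.dirac p, by
    have hd : ∀ B : Set (Space d × Y), MeasurableSet B →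
        Measure.dirac p B = 0 ∨ Measure.dirac p B = 1 := fun B hB => by
      rw [Measure.dirac_apply' p hB]
      exact Set.indicator_eq_zero_or_self B (1 : Space d × Y → ℝ≥0∞) p
    refine ⟨fun B hB => ?_, fun B hB hb => ?_⟩
    · rw [Measure.add_apply]
      rcases η.2.counting B hB with h | ⟨n, h⟩
      · exact Or.inl (by simp [h])
      · rcases hd B hB with h' | h'
        · exact Or.inr ⟨n, by simp [h, h']⟩
        · exact Or.inr ⟨n + 1, by simp [h, h']⟩
    · rw [Measure.add_apply]
      refine ENNReal.add_lt_top.2 ⟨η.2.locallyFinite B hB hb, ?_⟩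
      rcases hd _ (hB.prod MeasurableSet.univ) with h' | h' <;> simp [h']⟩

/-- `Ψ` is a Poisson process on `ℝ^d × Y` with intensity measure `μ`. -/
structure IsPoissonProcess {Ω : Type*} [MeasurableSpace Ω] {d : ℕ} {Y : Type*} [MeasurableSpace Y]
    (Ψ : Ω → CountingMeasure d Y) (μ : Measure (Space d × Y)) (P : Measure Ω) : Prop where
  measurable : Measurable Ψ
  law : ∀ B : Set (Space d × Y), MeasurableSet B → μ B ≠ ∞ →
    P.map (fun ω => (Ψ ω).1 B) = (poissonMeasure (μ B).toNNReal).map (fun n : ℕ => (n : ℝ≥0∞))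
  law_top : ∀ B : Set (Space d × Y), MeasurableSet B → μ B = ∞ → ∀ᵐ ω ∂P, (Ψ ω).1 B = ∞
  indep : ∀ (m : ℕ) (B : Fin m → Set (Space d × Y)), (∀ i, MeasurableSet (B i)) →
    Pairwise (fun i j => Disjoint (B i) (B j)) → iIndepFun (fun i ω => (Ψ ω).1 (B i)) P

/-! ### Simplicial complexes -/

/-- Finite simplicial complexes with vertices in `X`. -/
abbrev FinComplex (X : Type*) : Type _ :=
  {K : PreAbstractSimplicialComplex X // K.faces.Finite}

open Classical in
/-- The translate `K + t` of a complex `K` with vertices in `ℝ^d × 𝔸`. -/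
noncomputable def translate {d : ℕ} {A : Type*} (K : FinComplex (Space d × A)) (t : Space d) :
    FinComplex (Space d × A) :=
  ⟨K.1.map (fun v => (v.1 + t, v.2)), K.2.image _⟩

/-- Translation-invariance of a functional of finite simplicial complexes. -/
def IsTranslationInvariant {d : ℕ} {A : Type*} (f : FinComplex (Space d × A) → ℝ) : Prop :=
  ∀ (t : Space d) (K : FinComplex (Space d × A)), f K = f (translate K t)

/-- The restriction of a complex to the simplices with vertices in `W × 𝔸`. -/
def restrict {d : ℕ} {A : Type*} (K : PreAbstractSimplicialComplex (Space d × A))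
    (W : Set (Space d)) : PreAbstractSimplicialComplex (Space d × A) where
  faces := {σ | σ ∈ K.faces ∧ ∀ v ∈ σ, v.1 ∈ W}
  isRelLowerSet_faces := fun {_} hσ =>
    ⟨(K.isRelLowerSet_faces hσ.1).1, fun _ hρ hne =>
      ⟨(K.isRelLowerSet_faces hσ.1).2 hρ hne, fun v hv => hσ.2 v (hρ hv)⟩⟩

/-! ### The random connection model -/

/-- The connection functions `φ_1, …, φ_α`; the function with index `j : Fin α` is `φ_{j+1}`,
with `j + 2` arguments. -/
structure ConnectionFunctions (d : ℕ) (A : Type*) [MeasurableSpace A] (α : ℕ) where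
  φ : (j : Fin α) → (Fin (j + 2) → Space d × A) → unitInterval
  measurable : ∀ j, Measurable (φ j)
  symmetric : ∀ (j : Fin α) (x : Fin (j + 2) → Space d × A) (π : Equiv.Perm (Fin (j + 2))),
    φ j (x ∘ π) = φ j x
  translationInvariant : ∀ (j : Fin α) (x : Fin (j + 2) → Space d × A) (t : Space d),
    φ j (fun i => ((x i).1 + t, (x i).2)) = φ j x

/-- The space `𝕄 = M^(2) × ⋯ × M^(2α)`. The factor with index `j : Fin α` is `M^(2(j+1))`, whose
elements have a component in `[0,1]` for every `(j+1)`-tuple of pairs of natural numbers. -/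
abbrev MarkSpace (α : ℕ) : Type :=
  (j : Fin α) → (Fin (j + 1) → ℕ × ℕ) → unitInterval

/-- The product `ℚ` of uniform distributions on `𝕄`. -/
noncomputable def markMeasure (α : ℕ) : Measure (MarkSpace α) :=
  Measure.pi fun j : Fin α =>
    Measure.infinitePi fun _ : Fin (j + 1) → ℕ × ℕ => (volume : Measure unitInterval)

/-- The space `𝔸 × [0,1] × 𝕄`. -/
abbrev ExtMark (A : Type*) (α : ℕ) : Type _ := A × unitInterval × MarkSpace α

/-- The intensity measure `γ λ_d ⊗ Θ ⊗ 𝒰([0,1]) ⊗ ℚ`. -/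
noncomputable def intensity (d : ℕ) {A : Type*} [MeasurableSpace A] (α : ℕ) (γ : ℝ)
    (Θ : Measure A) : Measure (Space d × ExtMark A α) :=
  ENNReal.ofReal γ •
    (volume : Measure (Space d)).prod (Θ.prod ((volume : Measure unitInterval).prod (markMeasure α)))

section Model

variable {d : ℕ} {A : Type*} {α : ℕ}

/-- The projection of `(x, a, t, u)` to `(x, a)`. -/
def vertex (p : Space d × ExtMark A α) : Space d × A := (p.1, p.2.1)

/-- The component `t` of `(x, a, t, u)`. -/
def time (p : Space d × ExtMark A α) : unitInterval := p.2.2.1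

/-- The component `u` of `(x, a, t, u)`. -/
def mark (p : Space d × ExtMark A α) : MarkSpace α := p.2.2.2

/-- The unit cube `[0,1)^d + k`, for `k ∈ ℤ^d`. -/
def unitCube (k : Fin d → ℤ) : Set (Space d) :=
  {x | ∀ i, (k i : ℝ) ≤ x i ∧ x i < k i + 1}

/-- With respect to the enumeration `z` of `ℤ^d`, the unique `k` for which `x` lies in the unit cube
`Q_k = [0,1)^d + z_k`. -/
noncomputable def cubeIndex (z : ℕ ≃ (Fin d → ℤ)) (x : Space d) : ℕ := z.symm fun i => ⌊x i⌋

theorem mem_unitCube_iff (z : ℕ ≃ (Fin d → ℤ)) (x : Space d) (k : ℕ) :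
    x ∈ unitCube (z k) ↔ cubeIndex z x = k := by
  rw [cubeIndex, Equiv.symm_apply_eq, funext_iff]
  exact forall_congr' fun i => Int.floor_eq_iff.symm

variable [MeasurableSpace A]

/-- The coordinates `(k, i)` of a point `p` of `ψ`: it lies over `Q_k`, and it is the `i`-th smallest
of the points of `ψ` over `Q_k`, in the order of their `t`-components. -/
noncomputable def coords (z : ℕ ≃ (Fin d → ℤ)) (ψ : CountingMeasure d (ExtMark A α))
    (p : Space d × ExtMark A α) : ℕ × ℕ :=
  (cubeIndex z p.1,
    {q ∈ points ψ | q.1 ∈ unitCube (z (cubeIndex z p.1)) ∧ time q < time p}.ncard + 1)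

/-- The simplicial complex `T(ψ)` built from `ψ`. The simplices have at most `α + 1` vertices, all of
them points of the projection of `ψ`. Such a set `σ` is a simplex if for each subset
`ρ = {(x_0,a_0), …, (x_j,a_j)}` with at least two elements, where `t_0 < ⋯ < t_j`, the component of
`u^(j)` with index `(m_0,l_0,…,m_{j-1},l_{j-1})`, the coordinates of the first `j` points, is at most
`φ_j(ρ)`. (The index `j` below is one less than here.) -/
def complex (z : ℕ ≃ (Fin d → ℤ)) (Φ : ConnectionFunctions d A α)
    (ψ : CountingMeasure d (ExtMark A α)) : PreAbstractSimplicialComplex (Space d × A) where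
  faces := {σ | σ.Nonempty ∧ σ.card ≤ α + 1 ∧ (∀ v ∈ σ, v ∈ vertex '' points ψ) ∧
    ∀ (j : Fin α) (p : Fin (j + 2) → Space d × ExtMark A α),
      (∀ i, p i ∈ points ψ) → (∀ i, vertex (p i) ∈ σ) → StrictMono (fun i => time (p i)) →
      mark (p (Fin.last (j + 1))) j (fun i : Fin (j + 1) => coords z ψ (p i.castSucc)) ≤
        Φ.φ j (fun i => vertex (p i))}
  isRelLowerSet_faces := fun {_} hσ =>
    ⟨hσ.1, fun _ hρ hne =>
      ⟨hne, (Finset.card_le_card hρ).trans hσ.2.1, fun v hv => hσ.2.2.1 v (hρ hv),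
        fun j p hp hv ht => hσ.2.2.2 j p hp (fun i => hρ (hv i)) ht⟩⟩

theorem finite_points_of_isBounded {Y : Type*} [MeasurableSpace Y] [MeasurableSingletonClass Y]
    (ψ : CountingMeasure d Y) {W : Set (Space d)} (hW : Bornology.IsBounded W) :
    {p ∈ points ψ | p.1 ∈ W}.Finite := by
  set B : Set (Space d) := closure W
  have hB : MeasurableSet B := isClosed_closure.measurableSet
  have hfin : ψ.1 (B ×ˢ (Set.univ : Set Y)) ≠ ∞ :=
    (ψ.2.locallyFinite B hB hW.closure).ne
  have hsub : {p ∈ points ψ | p.1 ∈ W} ⊆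
      {p | 1 ≤ (ψ.1.restrict (B ×ˢ (Set.univ : Set Y))) {p}} := by
    rintro p ⟨hp, hpW⟩
    have hmem : p ∈ B ×ˢ (Set.univ : Set Y) := ⟨subset_closure hpW, trivial⟩
    have h1 : ψ.1 {p} ≠ 0 := hp
    rw [Set.mem_ofPred_eq, Measure.restrict_apply (measurableSet_singleton p),
      Set.inter_eq_left.2 (Set.singleton_subset_iff.2 hmem)]
    rcases ψ.2.counting {p} (measurableSet_singleton p) with h | ⟨n, h⟩
    · simp [h]
    · rw [h] at h1 ⊢
      exact_mod_cast Nat.one_le_iff_ne_zero.2 (by exact_mod_cast h1)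
  refine Set.Finite.subset ?_ hsub
  exact Measure.finite_const_le_meas_of_disjoint_iUnion _ zero_lt_one
    (fun p => measurableSet_singleton p)
    (fun p q hpq => Set.disjoint_singleton.2 hpq)
    (ne_top_of_le_ne_top (by rwa [Measure.restrict_apply_univ]) (measure_mono (Set.subset_univ _)))

theorem finite_restrict_complex [MeasurableSingletonClass A] (z : ℕ ≃ (Fin d → ℤ))
    (Φ : ConnectionFunctions d A α) (ψ : CountingMeasure d (ExtMark A α)) {W : Set (Space d)}
    (hW : Bornology.IsBounded W) : (restrict (complex z Φ ψ) W).faces.Finite := by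
  have hV := (finite_points_of_isBounded ψ hW).image (vertex (A := A) (α := α))
  refine (hV.finite_subsets.preimage (f := fun σ : Finset (Space d × A) => (σ : Set _))
    Finset.coe_injective.injOn).subset ?_
  rintro σ ⟨⟨-, -, hσ, -⟩, hσW⟩ v hv
  obtain ⟨p, hp, rfl⟩ := hσ v hv
  exact ⟨p, ⟨hp, hσW _ hv⟩, rfl⟩

/-- The finite complex `T(ψ)_W`, for bounded `W`. -/
def complexIn [MeasurableSingletonClass A] (z : ℕ ≃ (Fin d → ℤ)) (Φ : ConnectionFunctions d A α)
    (ψ : CountingMeasure d (ExtMark A α)) (W : Set (Space d)) (hW : Bornology.IsBounded W) :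
    FinComplex (Space d × A) :=
  ⟨restrict (complex z Φ ψ) W, finite_restrict_complex z Φ ψ hW⟩

/-- The difference operator
`Λ_{(x,a,t,u)} f(Δ_W) = f(Δ_W^{(x,a,t,u)}) - f(Δ_{W ∖ {x}}^{(x,a,t,u)})`, where `Δ = T(ψ)` and
`Δ^{(x,a,t,u)} = T(ψ + δ_{(x,a,t,u)})`. -/
noncomputable def diffOp [MeasurableSingletonClass A] (z : ℕ ≃ (Fin d → ℤ))
    (Φ : ConnectionFunctions d A α) (f : FinComplex (Space d × A) → ℝ)
    (p : Space d × ExtMark A α) (ψ : CountingMeasure d (ExtMark A α))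
    (W : Set (Space d)) (hW : Bornology.IsBounded W) : ℝ :=
  f (complexIn z Φ (addPoint ψ p) W hW) -
    f (complexIn z Φ (addPoint ψ p) (W \ {p.1}) (hW.subset Set.sdiff_subset))

end Model

/-! ### Cubes and weak stabilization -/

/-- Half-open cubes `∏ᵢ [cᵢ, cᵢ + s)` with `s > 0`. -/
structure Cube (d : ℕ) where
  corner : Space d
  side : ℝ
  side_pos : 0 < side

/-- The set of points of a cube. -/
def Cube.toSet {d : ℕ} (W : Cube d) : Set (Space d) :=
  {x | ∀ i, W.corner i ≤ x i ∧ x i < W.corner i + W.side}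

theorem Cube.isBounded {d : ℕ} (W : Cube d) : Bornology.IsBounded W.toSet := by
  have h : Bornology.IsBounded (Set.Icc (fun i => W.corner i) (fun i => W.corner i + W.side)) :=
    Metric.isBounded_Icc _ _
  refine ((PiLp.antilipschitzWith_ofLp 2 (fun _ : Fin d => ℝ)).isBounded_preimage h).subset ?_
  exact fun x hx => ⟨fun i => (hx i).1, fun i => (hx i).2.le⟩

/-- `W_n → ℝ^d`: every bounded set is contained in `W_n` for all sufficiently large `n`. -/
def TendsToSpace {d : ℕ} (W : ℕ → Cube d) : Prop :=
  ∀ B : Set (Space d), Bornology.IsBounded B → ∃ N : ℕ, ∀ n ≥ N, B ⊆ (W n).toSet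

/-- The random variable `Λ_{(0,V,1,U)} f(Δ_W)` with `Δ = T(Ψ)`. -/
noncomputable def originDiff {Ω : Type*} {d : ℕ} {A : Type*} [MeasurableSpace A]
    [MeasurableSingletonClass A] {α : ℕ} (z : ℕ ≃ (Fin d → ℤ)) (Φ : ConnectionFunctions d A α)
    (Ψ : Ω → CountingMeasure d (ExtMark A α)) (V : Ω → A) (U : Ω → MarkSpace α)
    (f : FinComplex (Space d × A) → ℝ) (W : Cube d) (ω : Ω) : ℝ :=
  diffOp z Φ f (0, V ω, 1, U ω) (Ψ ω) W.toSet W.isBounded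

/-- Weakly stabilizing functionals. -/
def IsWeaklyStabilizing {Ω : Type*} [MeasurableSpace Ω] (P : Measure Ω) {d : ℕ} {A : Type*}
    [MeasurableSpace A] [MeasurableSingletonClass A] {α : ℕ} (z : ℕ ≃ (Fin d → ℤ))
    (Φ : ConnectionFunctions d A α) (Ψ : Ω → CountingMeasure d (ExtMark A α)) (V : Ω → A)
    (U : Ω → MarkSpace α) (f : FinComplex (Space d × A) → ℝ) : Prop :=
  IsTranslationInvariant f ∧
    ∃ Z : Ω → ℝ, Measurable Z ∧ ∀ W : ℕ → Cube d, TendsToSpace W →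
      TendstoInMeasure P (fun n => originDiff z Φ Ψ V U f (W n)) atTop Z

end RCM

namespace RCM

/-! Only the passage from (ii) to a single limit needs an argument, and it concerns an arbitrary
family of functions indexed by cubes. The limit along the centered cubes serves as the candidate
`Z`. Any exhausting sequence, monotone or not, can be threaded with centered cubes into one
increasing sequence (`exists_interlacing`). Convergence along that sequence forces its even and odd
terms to share a limit, and the even terms already tend to `Z`. The subsequence principle then gives
convergence along the whole sequence (`exists_common_limit`). -/

/-- The cube `[-(n+1), n+1)^d`. -/
noncomputable def centeredCube (d : ℕ) (n : ℕ) : Cube d where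
  corner := WithLp.toLp 2 fun _ => -((n : ℝ) + 1)
  side := 2 * ((n : ℝ) + 1)
  side_pos := by positivity

theorem mem_centeredCube {d n : ℕ} {x : Space d} :
    x ∈ (centeredCube d n).toSet ↔ ∀ i, -((n : ℝ) + 1) ≤ x i ∧ x i < (n : ℝ) + 1 := by
  refine forall_congr' fun i => and_congr Iff.rfl ?_
  change x i < -((n : ℝ) + 1) + 2 * ((n : ℝ) + 1) ↔ _
  rw [show -((n : ℝ) + 1) + 2 * ((n : ℝ) + 1) = (n : ℝ) + 1 by ring]

theorem monotone_centeredCube (d : ℕ) : Monotone fun n => (centeredCube d n).toSet := by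
  intro m n hmn x hx
  have h : (m : ℝ) ≤ n := by exact_mod_cast hmn
  rw [mem_centeredCube] at hx ⊢
  exact fun i => ⟨by linarith [(hx i).1], by linarith [(hx i).2]⟩

theorem tendsToSpace_centeredCube (d : ℕ) : TendsToSpace (centeredCube d) := by
  intro B hB
  obtain ⟨R, hR⟩ := hB.exists_norm_le
  obtain ⟨N, hN⟩ := exists_nat_ge R
  refine ⟨N, fun n hn x hx => mem_centeredCube.2 fun i => ?_⟩
  have h : (N : ℝ) ≤ n := by exact_mod_cast hn
  have hxi : |x i| ≤ R := (PiLp.norm_apply_le x i).trans (hR x hx)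
  -- The extra `1` in the half-width makes the upper inequality strict, as the half-open cube
  -- demands; it also keeps the side positive at `n = 0`.
  exact ⟨by linarith [(abs_le.1 hxi).1], by linarith [(abs_le.1 hxi).2]⟩

theorem TendsToSpace.comp {d : ℕ} {W : ℕ → Cube d} (hW : TendsToSpace W) {u : ℕ → ℕ}
    (hu : Tendsto u atTop atTop) : TendsToSpace (W ∘ u) := fun B hB => by
  obtain ⟨N, hN⟩ := hW B hB
  obtain ⟨M, hM⟩ := eventually_atTop.1 (hu.eventually_ge_atTop N)
  exact ⟨M, fun n hn => hN _ (hM n hn)⟩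

/-- Two sequences of cubes exhausting the space, the first one increasing, have subsequences that
interlace to an increasing exhausting sequence. -/
theorem exists_interlacing {d : ℕ} {C W : ℕ → Cube d} (hCmono : Monotone fun n => (C n).toSet)
    (hC : TendsToSpace C) (hW : TendsToSpace W) :
    ∃ (D : ℕ → Cube d) (a b : ℕ → ℕ), StrictMono a ∧ Monotone (fun n => (D n).toSet) ∧
      TendsToSpace D ∧ (∀ k, D (2 * k) = C (a k)) ∧ ∀ k, D (2 * k + 1) = W (b k) := by
  have hnext : ∀ n, ∃ m, (C n).toSet ⊆ (W m).toSet := fun n =>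
    let ⟨N, hN⟩ := hW _ (C n).isBounded
    ⟨N, hN N le_rfl⟩
  choose β hβ using hnext
  -- Requiring `n < m` makes the chosen indices strictly increasing, so that the even terms form a
  -- genuine subsequence of `C`.
  have hback : ∀ n, ∃ m, n < m ∧ (W (β n)).toSet ⊆ (C m).toSet := fun n =>
    let ⟨N, hN⟩ := hC _ (W (β n)).isBounded
    ⟨max N (n + 1), lt_max_of_lt_right n.lt_succ_self, hN _ (le_max_left _ _)⟩
  choose s hs hsub using hback
  set a : ℕ → ℕ := fun k => s^[k] 0
  have hsucc : ∀ k, a (k + 1) = s (a k) := fun k => Function.iterate_succ_apply' s k 0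
  have hmono : StrictMono a := strictMono_nat_of_lt_succ fun k => by rw [hsucc]; exact hs _
  -- The chain is `C (a k) ⊆ W (β (a k)) ⊆ C (a (k + 1))`, so `D` is increasing although `W` need
  -- not be.
  set D : ℕ → Cube d := fun n => if Even n then C (a (n / 2)) else W (β (a (n / 2))) with hD
  have heven : ∀ k, D (2 * k) = C (a k) := fun k => by simp [hD]
  have hodd : ∀ k, D (2 * k + 1) = W (β (a k)) := fun k => by
    simp [hD, show (2 * k + 1) / 2 = k by omega]
  have hDmono : Monotone fun n => (D n).toSet := by
    refine monotone_nat_of_le_succ fun n => ?_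
    obtain ⟨k, rfl | rfl⟩ := n.even_or_odd'
    · rw [heven, hodd]
      exact hβ _
    · rw [hodd, show 2 * k + 1 + 1 = 2 * (k + 1) by ring, heven, hsucc]
      exact hsub _
  refine ⟨D, a, fun k => β (a k), hmono, hDmono, fun B hB => ?_, heven, hodd⟩
  obtain ⟨N, hN⟩ := hC B hB
  refine ⟨2 * N, fun n hn => (hN N le_rfl).trans ?_⟩
  -- Since `N ≤ a N`, monotonicity of `C` carries the bounded set from `C N` into `C (a N) = D (2 *
  -- N)`.
  refine (hCmono (hmono.le_apply (x := N))).trans ?_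
  change (C (a N)).toSet ⊆ (D n).toSet
  rw [← heven]
  exact hDmono hn

/-- If the values of `X` converge in measure along every increasing sequence of cubes that exhausts
the space, they converge to one common limit along every exhausting sequence of cubes. -/
theorem exists_common_limit {Ω : Type*} [MeasurableSpace Ω] {P : Measure Ω} {d : ℕ}
    {X : Cube d → Ω → ℝ}
    (h : ∀ W : ℕ → Cube d, Monotone (fun n => (W n).toSet) → TendsToSpace W →
      ∃ Z : Ω → ℝ, Measurable Z ∧ TendstoInMeasure P (fun n => X (W n)) atTop Z) :
    ∃ Z : Ω → ℝ, Measurable Z ∧ ∀ W : ℕ → Cube d, TendsToSpace W →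
      TendstoInMeasure P (fun n => X (W n)) atTop Z := by
  obtain ⟨Z, hZ, hCZ⟩ := h _ (monotone_centeredCube d) (tendsToSpace_centeredCube d)
  -- For fixed `ε` the claim is convergence of a sequence of measures, so it suffices to refine each
  -- `W ∘ ns`.
  refine ⟨Z, hZ, fun W hW ε hε => tendsto_of_subseq_tendsto fun ns hns => ?_⟩
  obtain ⟨D, a, b, ha, hDmono, hD, heven, hodd⟩ :=
    exists_interlacing (monotone_centeredCube d) (tendsToSpace_centeredCube d) (hW.comp hns)
  -- `Z'` may depend on `D`, hence on `ns`; almost sure uniqueness of limits along the even terms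
  -- identifies it with `Z`.
  obtain ⟨Z', -, hDZ'⟩ := h D hDmono hD
  have h2 : Tendsto (fun k : ℕ => 2 * k) atTop atTop :=
    tendsto_id.const_mul_atTop' two_pos
  have hae : Z' =ᵐ[P] Z := by
    refine tendstoInMeasure_ae_unique (hDZ'.comp h2) ?_
    simpa only [Function.comp_def, heven] using hCZ.comp ha.tendsto_atTop
  have hWZ : TendstoInMeasure P (fun k => X (W (ns (b k)))) atTop Z := by
    have := (hDZ'.comp (tendsto_add_atTop_nat 1 |>.comp h2)).congr_right hae
    simpa only [Function.comp_def, hodd] using this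
  -- The principle asks nothing of `b`: if convergence failed, some `ns` would stay outside a
  -- neighborhood of the limit at every index, so any selection from it would too.
  exact ⟨b, hWZ ε hε⟩

end RCM

theorem mainTheorem11 {Ω : Type*} [MeasurableSpace Ω] (P : Measure Ω) [IsProbabilityMeasure P]
    {d : ℕ} (hd : 1 ≤ d) {A : Type*} [MeasurableSpace A] [StandardBorelSpace A]
    (Θ : Measure A) [IsProbabilityMeasure Θ] (γ : ℝ) (hγ : 0 < γ)
    {α : ℕ} (hα : 1 ≤ α) (Φ : RCM.ConnectionFunctions d A α)
    (z : ℕ ≃ (Fin d → ℤ)) (hz : z 0 = 0)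
    (Ψ : Ω → RCM.CountingMeasure d (RCM.ExtMark A α))
    (hΨ : RCM.IsPoissonProcess Ψ (RCM.intensity d α γ Θ) P)
    (V : Ω → A) (hV : Measurable V) (hVlaw : P.map V = Θ)
    (U : Ω → RCM.MarkSpace α) (hU : Measurable U) (hUlaw : P.map U = RCM.markMeasure α)
    (hVU : IndepFun V U P) (hVUΨ : IndepFun (fun ω => (V ω, U ω)) Ψ P)
    (f : RCM.FinComplex (RCM.Space d × A) → ℝ) (hf : RCM.IsTranslationInvariant f) :
    RCM.IsWeaklyStabilizing P z Φ Ψ V U f ↔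
      ∀ W : ℕ → RCM.Cube d, Monotone (fun n => (W n).toSet) → RCM.TendsToSpace W →
        ∃ Z : Ω → ℝ, Measurable Z ∧
          TendstoInMeasure P (fun n => RCM.originDiff z Φ Ψ V U f (W n)) atTop Z := by
  constructor
  · rintro ⟨-, Z, hZ, hlim⟩ W - hW
    exact ⟨Z, hZ, hlim W hW⟩
  · exact fun h => ⟨hf, RCM.exists_common_limit h⟩
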